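/- Let $p$ be a prime, let $q=p^l$ with $l\ge 1$, let $\mathbb F_q$ be a finite field with $q$ elements, let $n\ge 2$ and $k\ge 1$ be integers, and let $M_{n,q}=M_n(\mathbb F_q)$ be the ring of $n\times n$ matrices over $\mathbb F_q$. Put $$P:=\{A^k+B^k\mid A,B\in M_{n,q}\},\qquad d_m:=\gcd(k,q^m-1)\ (m\ge 1),\qquad d:=d_1.$$ Suppose that $p$ does not divide $k$ and that $$q\ \ge\ \max\Bigl\{\sqrt{(d-1)^6+6d},\ (d_2-1)^2+1,\ \bigl\lfloor (d_3-1)^{4/3}\bigr\rfloor+1\Bigr\}.$$ Then $P=M_{n,q}$; that is, every $n\times n$ matrix over $\mathbb F_q$ is a sum of two $k$-th powers of $n\times n$ matrices over $\mathbb F_q$. -/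

import Mathlib

/-- The set `P` of sums `A ^ k + B ^ k` of two `k`-th powers of `n × n` matrices over `F`. -/
def sumTwoPowers (k n : ℕ) (F : Type*) [Field F] : Set (Matrix (Fin n) (Fin n) F) :=
  {X | ∃ A B : Matrix (Fin n) (Fin n) F, X = A ^ k + B ^ k}

/-- `d_m = gcd(k, q ^ m - 1)`. The subtraction is the usual one whenever `q ≥ 1`. -/
def dGcd (k q m : ℕ) : ℕ := Nat.gcd k (q ^ m - 1)

/-!
A matrix that is not scalar is conjugate to one with any prescribed diagonal of the same trace
(Fillmore). Write the diagonal entries as `aᵢ ^ k + bᵢ ^ k`; the matrix is then the sum of a lower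
triangular matrix with diagonal `aᵢ ^ k` and an upper triangular one with diagonal `bᵢ ^ k`. Such a
triangular matrix `T` has a `k`-th root that is a polynomial in `T` as soon as at most one diagonal
entry vanishes: interpolate `k`-th roots at the eigenvalues, then lift along nilpotents by Newton's
method, as `k` is invertible. So it is enough to write the trace as
`x₁ ^ k + y₁ ^ k + x₂ ^ k + y₂ ^ k + 2 (n - 2)` with `x₁, x₂ ≠ 0`. By Gauss sum estimates the map
`(x, y) ↦ x ^ k + y ^ k` on `Fˣ × F` has few collisions, so its range is more than half of `F`, and
two such ranges sum to `F`.

For a scalar matrix, Jacobi sum estimates solve `x ^ k + y ^ k = t` in the extensions of degrees 2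
and 3, and multiplication operators on a product of such extensions of total dimension `n` give
matrices.
-/

open Finset Polynomial

section PowerCharacters

variable {F : Type*} [Field F]

theorem sum_mulChar_apply_eq_zero [Fintype (MulChar F ℂ)] [Finite F] {a : F} (ha : a ≠ 1) :
    ∑ χ : MulChar F ℂ, χ a = 0 := by
  obtain ⟨χ₀, hχ₀⟩ := MulChar.exists_apply_ne_one_of_hasEnoughRootsOfUnity F ℂ ha
  have translate : χ₀ a * ∑ χ : MulChar F ℂ, χ a = ∑ χ : MulChar F ℂ, χ a := by
    simp_rw [mul_sum, ← MulChar.mul_apply]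
    exact Fintype.sum_equiv (Equiv.mulLeft χ₀) _ _ fun _ => rfl
  exact eq_zero_of_mul_eq_self_left hχ₀ translate

/-- The nontrivial complex multiplicative characters `χ` of `F` with `χ ^ k = 1`: the nontrivial
characters in the expansion of the number of `k`-th roots as a function on `F`. -/
noncomputable def nontrivialTorsionChars (F : Type*) [Field F] [Finite F] (k : ℕ) :
    Finset (MulChar F ℂ) :=
  (Set.toFinite {χ : MulChar F ℂ | χ ^ k = 1 ∧ χ ≠ 1}).toFinset

theorem mem_nontrivialTorsionChars [Finite F] {k : ℕ} {χ : MulChar F ℂ} :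
    χ ∈ nontrivialTorsionChars F k ↔ χ ^ k = 1 ∧ χ ≠ 1 := by
  simp [nontrivialTorsionChars]

theorem card_nontrivialTorsionChars (F : Type*) [Field F] [Finite F] (k : ℕ) :
    #(nontrivialTorsionChars F k) = k.gcd (Nat.card F - 1) - 1 := by
  obtain ⟨e⟩ := MulChar.mulEquiv_units F ℂ
  have : IsCyclic (MulChar F ℂ) := e.isCyclic.mpr inferInstance
  have hker : (nontrivialTorsionChars F k : Set (MulChar F ℂ)) =
      ((powMonoidHom k : MulChar F ℂ →* _).ker : Set (MulChar F ℂ)) \ {1} := by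
    ext χ
    simp [mem_nontrivialTorsionChars, MonoidHom.mem_ker]
  rw [← Set.ncard_coe_finset, hker, Set.ncard_sdiff_singleton_of_mem (one_mem _),
    ← Nat.card_coe_set_eq, SetLike.coe_sort_coe, IsCyclic.card_powMonoidHom_ker,
    Nat.card_congr e.toEquiv, Nat.card_units, Nat.gcd_comm]

theorem card_filter_pow_eq [Fintype F] [DecidableEq F] {k : ℕ} (hk : k ≠ 0) (u : F) :
    (#{x : F | x ^ k = u} : ℂ) = 1 + ∑ χ ∈ nontrivialTorsionChars F k, χ u := by
  classical
  rcases eq_or_ne u 0 with rfl | hu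
  · simp [MulChar.map_zero, hk, filter_eq']
  have : Fintype (MulChar F ℂ) := Fintype.ofFinite _
  have hq : (Fintype.card Fˣ : ℂ) ≠ 0 := by simp
  have hsum_pow (χ : MulChar F ℂ) :
      ∑ x, χ (x ^ k) = if χ ^ k = 1 then (Fintype.card Fˣ : ℂ) else 0 := by
    simp_rw [map_pow, ← MulChar.pow_apply' χ hk]
    split_ifs with h
    · rw [h, MulChar.sum_one_eq_card_units]
    · exact MulChar.sum_eq_zero_of_ne_one h
  have hsum_char (x : F) :
      ∑ χ : MulChar F ℂ, χ (x ^ k * u⁻¹) = if x ^ k = u then (Fintype.card Fˣ : ℂ) else 0 := by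
    split_ifs with h
    · simp_rw [h, mul_inv_cancel₀ hu, map_one, sum_const, card_univ, nsmul_one,
        ← Nat.card_eq_fintype_card, MulChar.card_eq_card_units_of_hasEnoughRootsOfUnity]
    · exact sum_mulChar_apply_eq_zero fun h' => h (by field_simp at h'; exact h')
  refine mul_left_cancel₀ hq ?_
  calc (Fintype.card Fˣ : ℂ) * #{x : F | x ^ k = u}
      = ∑ x, ∑ χ : MulChar F ℂ, χ (x ^ k * u⁻¹) := by
        simp_rw [hsum_char, ← sum_filter, sum_const, nsmul_eq_mul, mul_comm]
    _ = ∑ χ : MulChar F ℂ, (∑ x, χ (x ^ k)) * χ⁻¹ u := by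
        rw [sum_comm]
        simp_rw [sum_mul, map_mul, MulChar.inv_apply']
    _ = ∑ χ : MulChar F ℂ with χ ^ k = 1, (Fintype.card Fˣ : ℂ) * χ⁻¹ u := by
        simp_rw [hsum_pow, ite_mul, zero_mul, sum_filter]
    _ = (Fintype.card Fˣ : ℂ) * ∑ χ : MulChar F ℂ with χ ^ k = 1, χ u := by
        rw [mul_sum]
        exact sum_equiv (Equiv.inv _) (by simp) fun _ _ => rfl
    _ = (Fintype.card Fˣ : ℂ) * (1 + ∑ χ ∈ nontrivialTorsionChars F k, χ u) := by
        have hinsert : ({χ : MulChar F ℂ | χ ^ k = 1} : Finset _) =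
            insert 1 (nontrivialTorsionChars F k) := by
          ext χ
          by_cases h : χ = 1 <;> simp [mem_nontrivialTorsionChars, h]
        rw [hinsert, sum_insert (by simp [mem_nontrivialTorsionChars]),
          MulChar.one_apply hu.isUnit]

theorem norm_mulChar_apply [Finite F] (χ : MulChar F ℂ) {u : F} (hu : u ≠ 0) : ‖χ u‖ = 1 := by
  lift u to Fˣ using hu.isUnit
  have hfin : IsOfFinOrder (u : F) := Units.isOfFinOrder_val.mpr (isOfFinOrder_of_finite u)
  exact (χ.toMonoidHom.isOfFinOrder hfin).norm_eq_one

variable [Fintype F]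

theorem norm_gaussSum {χ : MulChar F ℂ} (hχ : χ ≠ 1) {ψ : AddChar F ℂ} (hψ : ψ.IsPrimitive) :
    ‖gaussSum χ ψ‖ = √(Fintype.card F) := by
  rw [eq_comm, Real.sqrt_eq_iff_eq_sq (by positivity) (norm_nonneg _)]
  have h := gaussSum_mul_gaussSum_eq_card hχ hψ
  rw [← star_gaussSum_eq, RCLike.star_def, Complex.mul_conj'] at h
  exact Complex.ofReal_injective (by push_cast; exact h.symm)

theorem norm_jacobiSum_le {χ φ : MulChar F ℂ} (hχ : χ ≠ 1) (hφ : φ ≠ 1) :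
    ‖jacobiSum χ φ‖ ≤ √(Fintype.card F) := by
  have hq : (0 : ℝ) < √(Fintype.card F) := by simp [Fintype.card_pos]
  by_cases h : χ * φ = 1
  · obtain rfl : φ = χ⁻¹ := (inv_eq_of_mul_eq_one_right h).symm
    rw [jacobiSum_nontrivial_inv hχ, norm_neg, norm_mulChar_apply _ (by simp), Real.one_le_sqrt]
    exact_mod_cast Fintype.card_pos
  · have hψ := AddChar.FiniteField.primitiveChar_to_Complex_isPrimitive F
    have hnorm := congrArg norm
      (jacobiSum_mul_nontrivial h (AddChar.FiniteField.primitiveChar_to_Complex F))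
    rw [norm_mul, norm_mul, norm_gaussSum h hψ, norm_gaussSum hχ hψ, norm_gaussSum hφ hψ] at hnorm
    exact (mul_left_cancel₀ hq.ne' hnorm).le

theorem norm_sum_mul_apply_sub_le {χ φ : MulChar F ℂ} (hχ : χ ≠ 1) (hφ : φ ≠ 1) {t : F}
    (ht : t ≠ 0) : ‖∑ u, χ u * φ (t - u)‖ ≤ √(Fintype.card F) := by
  have hscale : ∑ u, χ u * φ (t - u) = χ t * φ t * jacobiSum χ φ := by
    rw [jacobiSum, mul_sum, ← Equiv.sum_comp (Equiv.mulLeft₀ t ht)]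
    refine sum_congr rfl fun u _ => ?_
    rw [Equiv.mulLeft₀_apply, ← mul_one_sub, map_mul, map_mul]
    ring
  rw [hscale, norm_mul, norm_mul, norm_mulChar_apply _ ht, norm_mulChar_apply _ ht, one_mul,
    one_mul]
  exact norm_jacobiSum_le hχ hφ

theorem norm_sum_addChar_pow_le {k : ℕ} (hk : k ≠ 0) {ψ : AddChar F ℂ} (hψ : ψ ≠ 1) :
    ‖∑ x, ψ (x ^ k)‖ ≤ (k.gcd (Fintype.card F - 1) - 1 : ℕ) * √(Fintype.card F) := by
  have := Classical.decEq F
  have expand : ∑ x, ψ (x ^ k) = ∑ χ ∈ nontrivialTorsionChars F k, gaussSum χ ψ := by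
    calc ∑ x, ψ (x ^ k)
        = ∑ u, (#{x : F | x ^ k = u} : ℂ) * ψ u := by
          rw [← sum_fiberwise' univ (fun x : F => x ^ k)]
          exact sum_congr rfl fun u _ => by rw [sum_const, nsmul_eq_mul]
      _ = ∑ u, ψ u + ∑ u, ∑ χ ∈ nontrivialTorsionChars F k, χ u * ψ u := by
          simp_rw [card_filter_pow_eq hk, add_mul, one_mul, sum_mul, sum_add_distrib]
      _ = ∑ χ ∈ nontrivialTorsionChars F k, gaussSum χ ψ := by
          rw [AddChar.sum_eq_zero_of_ne_one hψ, zero_add, sum_comm]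
          rfl
  rw [expand, ← Nat.card_eq_fintype_card, ← card_nontrivialTorsionChars, ← nsmul_eq_mul]
  refine norm_sum_le_of_le _ (fun χ hχ => ?_) |>.trans_eq (sum_const _)
  rw [Nat.card_eq_fintype_card]
  exact (norm_gaussSum (mem_nontrivialTorsionChars.mp hχ).2 (AddChar.IsPrimitive.of_ne_one hψ)).le

theorem sum_card_filter_pow_mul_card_filter_pow [DecidableEq F] {k : ℕ} (hk : k ≠ 0) (t : F) :
    (∑ u, #{x : F | x ^ k = u} * #{y : F | y ^ k = t - u} : ℂ) = Fintype.card F +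
      ∑ χ ∈ nontrivialTorsionChars F k, ∑ φ ∈ nontrivialTorsionChars F k,
        ∑ u, χ u * φ (t - u) := by
  set S := nontrivialTorsionChars F k
  have hsum : ∑ u, ∑ χ ∈ S, χ u = 0 := by
    rw [sum_comm]
    exact sum_eq_zero fun χ hχ => MulChar.sum_eq_zero_of_ne_one (mem_nontrivialTorsionChars.mp hχ).2
  have hsum_sub : ∑ u, ∑ χ ∈ S, χ (t - u) = 0 :=
    (Equiv.sum_comp (Equiv.subLeft t) fun u => ∑ χ ∈ S, χ u).trans hsum
  calc (∑ u, #{x : F | x ^ k = u} * #{y : F | y ^ k = t - u} : ℂ)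
      = ∑ u, (1 + ∑ φ ∈ S, φ (t - u) + ∑ χ ∈ S, χ u + (∑ χ ∈ S, χ u) * ∑ φ ∈ S, φ (t - u)) :=
        sum_congr rfl fun u _ => by
          rw [card_filter_pow_eq hk, card_filter_pow_eq hk]
          ring
    _ = Fintype.card F + ∑ u, ∑ χ ∈ S, ∑ φ ∈ S, χ u * φ (t - u) := by
        simp_rw [sum_add_distrib, hsum, hsum_sub, sum_mul_sum]
        simp
    _ = _ := by
        rw [sum_comm]
        exact congrArg _ (sum_congr rfl fun χ _ => sum_comm)

theorem exists_pow_add_pow_eq {k : ℕ} (hk : k ≠ 0)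
    (hcard : (k.gcd (Fintype.card F - 1) - 1) ^ 4 < Fintype.card F) (t : F) :
    ∃ x y : F, x ^ k + y ^ k = t := by
  classical
  rcases eq_or_ne t 0 with rfl | ht
  · exact ⟨0, 0, by simp [hk]⟩
  set S := nontrivialTorsionChars F k
  set q := Fintype.card F
  by_contra! hno
  have hcount : (q : ℂ) + ∑ χ ∈ S, ∑ φ ∈ S, ∑ u, χ u * φ (t - u) = 0 := by
    rw [← sum_card_filter_pow_mul_card_filter_pow hk]
    refine sum_eq_zero fun u _ => ?_
    rw [mul_eq_zero, Nat.cast_eq_zero, Nat.cast_eq_zero, card_eq_zero, card_eq_zero]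
    by_contra! ⟨⟨x, hx⟩, ⟨y, hy⟩⟩
    exact hno x y (by rw [(mem_filter.mp hx).2, (mem_filter.mp hy).2, add_sub_cancel])
  have hle : (q : ℝ) ≤ (#S : ℝ) ^ 2 * √q := by
    calc (q : ℝ) = ‖∑ χ ∈ S, ∑ φ ∈ S, ∑ u, χ u * φ (t - u)‖ := by
          rw [← norm_neg, ← eq_neg_of_add_eq_zero_left hcount, Complex.norm_natCast]
      _ ≤ ∑ _χ ∈ S, ∑ _φ ∈ S, √q := norm_sum_le_of_le _ fun χ hχ => norm_sum_le_of_le _ fun φ hφ =>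
          norm_sum_mul_apply_sub_le (mem_nontrivialTorsionChars.mp hχ).2
            (mem_nontrivialTorsionChars.mp hφ).2 ht
      _ = (#S : ℝ) ^ 2 * √q := by
          rw [sum_const, sum_const, nsmul_eq_mul, nsmul_eq_mul, sq, mul_assoc]
  have hq : (0 : ℝ) < √q := by simp [q, Fintype.card_pos]
  have hsqrt : √q ≤ (#S : ℝ) ^ 2 :=
    le_of_mul_le_mul_right (by rwa [Real.mul_self_sqrt q.cast_nonneg]) hq
  rw [Real.sqrt_le_left (by positivity), card_nontrivialTorsionChars,
    Nat.card_eq_fintype_card, ← pow_mul] at hsqrt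
  exact hcard.not_ge (by exact_mod_cast hsqrt)

end PowerCharacters

section Collisions

variable {ι κ α : Type*}

/-- The number of ordered pairs of indices on which the family `g` takes the same value. For a sum
map `(i, j) ↦ f i + h j` this is an additive energy, which bounds the size of the range of `g` from
below. -/
noncomputable def collisionCount (g : ι → α) : ℕ :=
  Nat.card {p : ι × ι // g p.1 = g p.2}

theorem collisionCount_comp_injective {β : Type*} {h : α → β} (hh : h.Injective) (g : ι → α) :
    collisionCount (h ∘ g) = collisionCount g := by
  simp only [collisionCount, Function.comp_apply, hh.eq_iff]

theorem collisionCount_monoidHom {G H : Type*} [Group G] [Group H] (f : G →* H) :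
    collisionCount f = Nat.card G * Nat.card f.ker := by
  rw [← Nat.card_prod]
  exact Nat.card_congr
    { toFun := fun p => (p.1.1, ⟨p.1.1⁻¹ * p.1.2, by simp [MonoidHom.mem_ker, p.2]⟩)
      invFun := fun p => ⟨(p.1, p.1 * p.2.1), by simp [MonoidHom.mem_ker.mp p.2.2]⟩
      left_inv := fun p => by simp
      right_inv := fun p => by simp }

theorem sq_card_le_card_image_mul_collisionCount [Fintype ι] [DecidableEq α] (g : ι → α) :
    Fintype.card ι ^ 2 ≤ #(univ.image g) * collisionCount g := by
  have hmaps : ((univ : Finset ι) : Set ι).MapsTo g (univ.image g) := fun i _ => by simp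
  have hcard : Fintype.card ι = ∑ a ∈ univ.image g, #{i | g i = a} :=
    card_eq_sum_card_fiberwise hmaps
  have hcoll : collisionCount g = ∑ a ∈ univ.image g, #{i | g i = a} ^ 2 := by
    rw [collisionCount, Nat.card_eq_fintype_card, Fintype.card_subtype,
      card_eq_sum_card_fiberwise (f := g ∘ Prod.fst) (t := univ.image g) fun i _ => by simp]
    refine sum_congr rfl fun a _ => ?_
    rw [sq, ← card_product]
    congr 1
    ext ⟨i, j⟩
    simp only [Function.comp_apply, mem_filter, mem_univ, true_and, mem_product]
    grind
  rw [hcard, hcoll]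
  exact sq_sum_le_card_mul_sum_sq

variable [Fintype ι] [Fintype κ] {G : Type*} [AddCommGroup G] [Fintype G]

theorem sum_norm_sq_sum_addChar (g : ι → G) :
    ∑ ψ : AddChar G ℂ, ‖∑ i, ψ (g i)‖ ^ 2 = Fintype.card G * collisionCount g := by
  classical
  have hcomplex : ∑ ψ : AddChar G ℂ, ((‖∑ i, ψ (g i)‖ : ℂ)) ^ 2 =
      Fintype.card G * collisionCount g := by
    calc ∑ ψ : AddChar G ℂ, ((‖∑ i, ψ (g i)‖ : ℂ)) ^ 2
        = ∑ ψ : AddChar G ℂ, ∑ p : ι × ι, ψ (g p.1 - g p.2) := sum_congr rfl fun ψ _ => by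
          rw [← Complex.mul_conj', map_sum, sum_mul_sum, Fintype.sum_prod_type]
          simp_rw [sub_eq_add_neg, AddChar.map_add_eq_mul, AddChar.map_neg_eq_conj]
      _ = ∑ p : ι × ι, if g p.1 = g p.2 then (Fintype.card G : ℂ) else 0 := by
          rw [sum_comm]
          simp_rw [AddChar.sum_apply_eq_ite, sub_eq_zero]
      _ = Fintype.card G * collisionCount g := by
          rw [← sum_filter, sum_const, nsmul_eq_mul, mul_comm, collisionCount,
            Nat.card_eq_fintype_card, Fintype.card_subtype]
  exact_mod_cast hcomplex

theorem card_mul_collisionCount_add_le (g : ι → G) (h : κ → G) {B : ℝ}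
    (hB : ∀ ψ : AddChar G ℂ, ψ ≠ 1 → ‖∑ j, ψ (h j)‖ ^ 2 ≤ B) :
    (Fintype.card G * collisionCount fun p : ι × κ => g p.1 + h p.2 : ℝ) ≤
      (Fintype.card ι * Fintype.card κ) ^ 2 +
        (Fintype.card G * collisionCount g - Fintype.card ι ^ 2) * B := by
  classical
  have hfactor (ψ : AddChar G ℂ) :
      ‖∑ p : ι × κ, ψ (g p.1 + h p.2)‖ ^ 2 = ‖∑ i, ψ (g i)‖ ^ 2 * ‖∑ j, ψ (h j)‖ ^ 2 := by
    simp_rw [AddChar.map_add_eq_mul, Fintype.sum_prod_type, ← mul_sum, ← sum_mul]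
    rw [norm_mul, mul_pow]
  rw [← sum_norm_sq_sum_addChar, ← sum_norm_sq_sum_addChar]
  simp_rw [hfactor]
  have hsplit (f : AddChar G ℂ → ℝ) : ∑ ψ, f ψ = f 1 + ∑ ψ ∈ univ.erase 1, f ψ :=
    (add_sum_erase univ f (mem_univ 1)).symm
  rw [hsplit, hsplit fun ψ => ‖∑ i, ψ (g i)‖ ^ 2]
  simp only [AddChar.one_apply, sum_const, card_univ, nsmul_eq_mul, mul_one, Complex.norm_natCast]
  rw [add_sub_cancel_left, mul_pow, sum_mul]
  gcongr with ψ hψ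
  exact hB ψ (ne_of_mem_erase hψ)

theorem exists_add_eq_of_card_lt_two_mul_card {s : Finset G}
    (hs : Fintype.card G < 2 * #s) (t : G) : ∃ a ∈ s, ∃ b ∈ s, a + b = t := by
  classical
  have hcard : #(univ : Finset G) < #s + #(s.image (t - ·)) := by
    rwa [card_image_of_injective _ sub_right_injective, ← two_mul]
  obtain ⟨a, ha⟩ := inter_nonempty_of_card_lt_card_add_card (subset_univ _) (subset_univ _) hcard
  obtain ⟨ha, b, hb, rfl⟩ := by simpa using ha
  exact ⟨_, ha, b, hb, sub_add_cancel t b⟩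

end Collisions

section FourPowers

variable {F : Type*} [Field F] [Fintype F]

theorem collisionCount_units_pow (k : ℕ) :
    collisionCount (fun x : Fˣ => (x : F) ^ k) =
      (Fintype.card F - 1) * k.gcd (Fintype.card F - 1) := by
  rw [← Nat.card_eq_fintype_card, ← Nat.card_units, Nat.gcd_comm, ← IsCyclic.card_powMonoidHom_ker,
    ← collisionCount_monoidHom]
  exact collisionCount_comp_injective Units.val_injective (powMonoidHom k)

theorem collisionCount_units_pow_add_pow_le {k e : ℕ} (hk : k ≠ 0)
    (he : k.gcd (Fintype.card F - 1) = e + 1) :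
    (collisionCount fun p : Fˣ × F => (p.1 : F) ^ k + p.2 ^ k : ℝ) ≤
      (Fintype.card F - 1) * ((Fintype.card F - 1) * Fintype.card F +
        (Fintype.card F * e + 1) * e ^ 2) := by
  classical
  set q := Fintype.card F with hq
  have hq0 : (0 : ℝ) < q := by exact_mod_cast Fintype.card_pos
  have hunits : (Fintype.card Fˣ : ℝ) = q - 1 := by
    rw [Fintype.card_units, Nat.cast_pred Fintype.card_pos]
  have hbound (ψ : AddChar F ℂ) (hψ : ψ ≠ 1) : ‖∑ y, ψ (y ^ k)‖ ^ 2 ≤ e ^ 2 * q := by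
    rw [← Real.sq_sqrt hq0.le, ← mul_pow]
    gcongr
    simpa only [← hq, he, Nat.add_sub_cancel] using norm_sum_addChar_pow_le hk hψ
  have henergy := card_mul_collisionCount_add_le (fun x : Fˣ => (x : F) ^ k) _ hbound
  rw [collisionCount_units_pow, ← hq, he, hunits, Nat.cast_mul, Nat.cast_pred Fintype.card_pos,
    Nat.cast_succ] at henergy
  exact le_of_mul_le_mul_left (henergy.trans_eq (by ring)) hq0

theorem mul_add_one_mul_sq_lt {e q : ℕ} (h : e ^ 3 + 1 < q) :
    ((q : ℝ) * e + 1) * (e : ℝ) ^ 2 < (q - 1) * q := by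
  have hcube : (e : ℝ) ^ 3 + 1 ≤ q - 1 := by
    rw [le_sub_iff_add_le]
    exact_mod_cast h
  have hsq : (e : ℝ) ^ 2 < q := by
    have : e ^ 2 ≤ e ^ 3 + 1 := by
      rcases e.eq_zero_or_pos with rfl | he
      · simp
      · exact (Nat.pow_le_pow_right he (by norm_num)).trans (Nat.le_succ _)
    exact_mod_cast this.trans_lt h
  calc ((q : ℝ) * e + 1) * (e : ℝ) ^ 2 = (e : ℝ) ^ 3 * q + (e : ℝ) ^ 2 := by ring
    _ < (e : ℝ) ^ 3 * q + q := by gcongr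
    _ = ((e : ℝ) ^ 3 + 1) * q := by ring
    _ ≤ (q - 1) * q := by gcongr

theorem card_lt_two_mul_card_image_units_pow_add_pow [DecidableEq F] {k : ℕ} (hk : k ≠ 0)
    (hcard : (k.gcd (Fintype.card F - 1) - 1) ^ 3 + 1 < Fintype.card F) :
    Fintype.card F < 2 * #(univ.image fun p : Fˣ × F => (p.1 : F) ^ k + p.2 ^ k) := by
  obtain ⟨e, he⟩ : ∃ e, k.gcd (Fintype.card F - 1) = e + 1 :=
    Nat.exists_eq_succ_of_ne_zero (Nat.gcd_ne_zero_left hk)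
  have henergy := collisionCount_units_pow_add_pow_le hk he
  have hcauchy := sq_card_le_card_image_mul_collisionCount
    fun p : Fˣ × F => (p.1 : F) ^ k + p.2 ^ k
  rify at hcauchy
  rw [he, Nat.add_sub_cancel] at hcard
  rw [Fintype.card_prod, Fintype.card_units, Nat.cast_mul, Nat.cast_pred Fintype.card_pos]
    at hcauchy
  generalize #(univ.image fun p : Fˣ × F => (p.1 : F) ^ k + p.2 ^ k) = R at hcauchy ⊢
  generalize Fintype.card F = q at *
  have hq : (1 : ℝ) < q := by exact_mod_cast (Nat.le_add_left 1 _).trans_lt hcard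
  have : (0 : ℝ) < q - 1 := sub_pos.mpr hq
  rify
  by_contra! hle
  refine lt_irrefl (2 * (((q : ℝ) - 1) * q) ^ 2) ?_
  calc 2 * (((q : ℝ) - 1) * q) ^ 2
      ≤ 2 * R * collisionCount fun p : Fˣ × F => (p.1 : F) ^ k + p.2 ^ k := by
        rw [mul_assoc]
        gcongr
    _ ≤ q * ((q - 1) * ((q - 1) * q + (q * e + 1) * e ^ 2)) := by gcongr
    _ < q * ((q - 1) * ((q - 1) * q + (q - 1) * q)) := by
        gcongr ?_ * (?_ * (?_ + ?_))
        exact mul_add_one_mul_sq_lt hcard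
    _ = 2 * (((q : ℝ) - 1) * q) ^ 2 := by ring

theorem exists_pow_add_pow_add_pow_add_pow_eq {k : ℕ} (hk : k ≠ 0)
    (hcard : (k.gcd (Fintype.card F - 1) - 1) ^ 3 + 1 < Fintype.card F) (t : F) :
    ∃ x₁ y₁ x₂ y₂ : F, x₁ ≠ 0 ∧ x₂ ≠ 0 ∧ x₁ ^ k + y₁ ^ k + (x₂ ^ k + y₂ ^ k) = t := by
  classical
  obtain ⟨a, ha, b, hb, hab⟩ := exists_add_eq_of_card_lt_two_mul_card
    (card_lt_two_mul_card_image_units_pow_add_pow hk hcard) t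
  obtain ⟨⟨x₁, y₁⟩, -, rfl⟩ := mem_image.mp ha
  obtain ⟨⟨x₂, y₂⟩, -, rfl⟩ := mem_image.mp hb
  exact ⟨x₁, y₁, x₂, y₂, x₁.ne_zero, x₂.ne_zero, hab⟩

end FourPowers

section RootsOfMatrices

theorem exists_dvd_pow_sub_of_isCoprime {R : Type*} [CommRing R] {k N : ℕ} (hk : IsUnit (k : R))
    {f g₀ h : R[X]} (hcop : IsCoprime f g₀) (hdvd : f ∣ (g₀ ^ k - h) ^ N) :
    ∃ g : R[X], f ∣ g ^ k - h := by
  let P : (AdjoinRoot f)[X] := X ^ k - C (AdjoinRoot.mk f h)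
  have hP (g : R[X]) : aeval (AdjoinRoot.mk f g) P = AdjoinRoot.mk f (g ^ k - h) := by
    simp [P]
  have hnil : IsNilpotent (aeval (AdjoinRoot.mk f g₀) P) :=
    ⟨N, by rwa [hP, ← map_pow, AdjoinRoot.mk_eq_zero]⟩
  have hunit : IsUnit (aeval (AdjoinRoot.mk f g₀) (derivative P)) := by
    obtain ⟨u, v, huv⟩ := hcop
    have hg₀_unit : IsUnit (AdjoinRoot.mk f g₀) := by
      refine .of_mul_eq_one_right (AdjoinRoot.mk f v) ?_
      simpa using congrArg (AdjoinRoot.mk f) huv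
    have hk_unit : IsUnit (k : AdjoinRoot f) := by
      simpa using hk.map (algebraMap R (AdjoinRoot f))
    simpa [P, derivative_X_pow] using hk_unit.mul (hg₀_unit.pow (k - 1))
  obtain ⟨x, ⟨-, hx⟩, -⟩ := existsUnique_nilpotent_sub_and_aeval_eq_zero hnil hunit
  obtain ⟨g, rfl⟩ := AdjoinRoot.mk_surjective x
  exact ⟨g, AdjoinRoot.mk_eq_zero.mp (hP g ▸ hx)⟩

variable {F : Type*} [Field F]

theorem dvd_pow_card_roots_of_forall_isRoot {f h : F[X]} (hf : f.Splits) (hf0 : f ≠ 0)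
    (hroots : ∀ a ∈ f.roots, h.IsRoot a) : f ∣ h ^ f.roots.card := by
  conv_lhs => rw [hf.eq_prod_roots]
  rw [(isUnit_C.mpr (leadingCoeff_ne_zero.mpr hf0).isUnit).mul_left_dvd]
  have := Multiset.prod_dvd_prod_of_dvd (S := f.roots) (fun a => X - C a) (fun _ => h) fun a ha =>
    dvd_iff_isRoot.mpr (hroots a ha)
  simpa using this

theorem isCoprime_of_splits_of_forall_not_isRoot {f g : F[X]} (hf : f.Splits) (hf0 : f ≠ 0)
    (hroots : ∀ a ∈ f.roots, ¬ g.IsRoot a) : IsCoprime f g := by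
  rw [hf.eq_prod_roots, isCoprime_mul_unit_left_left
    (isUnit_C.mpr (leadingCoeff_ne_zero.mpr hf0).isUnit)]
  refine Multiset.prod_induction (IsCoprime · g) _ (fun _ _ => .mul_left) isCoprime_one_left ?_
  simp only [Multiset.mem_map]
  rintro _ ⟨a, ha, rfl⟩
  rw [(irreducible_X_sub_C a).coprime_iff_not_dvd, dvd_iff_isRoot]
  exact hroots a ha

theorem exists_dvd_pow_sub_X_of_eval_zero_ne_zero {k : ℕ} (hk : (k : F) ≠ 0) {f : F[X]}
    (hf : f.Splits) (hroots : ∀ a ∈ f.roots, ∃ b, b ^ k = a) (hf0 : f.eval 0 ≠ 0) :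
    ∃ g : F[X], f ∣ g ^ k - X := by
  classical
  have hf_ne : f ≠ 0 := by
    rintro rfl
    simp at hf0
  choose! r hr using hroots
  let g₀ := Lagrange.interpolate f.roots.toFinset id r
  have hg₀ : ∀ a ∈ f.roots, g₀.eval a = r a := fun a ha =>
    Lagrange.eval_interpolate_at_node r (Set.injOn_id _) (Multiset.mem_toFinset.mpr ha)
  have hroot_ne : ∀ a ∈ f.roots, ¬ g₀.IsRoot a := by
    intro a ha h0
    have ha0 : a = 0 := by
      rw [← hr a ha, ← hg₀ a ha, h0, zero_pow (by rintro rfl; simp at hk)]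
    subst ha0
    exact hf0 (isRoot_of_mem_roots ha)
  exact exists_dvd_pow_sub_of_isCoprime hk.isUnit
    (isCoprime_of_splits_of_forall_not_isRoot hf hf_ne hroot_ne)
    (dvd_pow_card_roots_of_forall_isRoot hf hf_ne fun a ha => by simp [hg₀ a ha, hr a ha])

theorem exists_dvd_pow_sub_X {k : ℕ} (hk : (k : F) ≠ 0) {f : F[X]}
    (hf : f.Splits) (hroots : ∀ a ∈ f.roots, ∃ b, b ^ k = a) (hf0 : ¬ X ^ 2 ∣ f) :
    ∃ g : F[X], f ∣ g ^ k - X := by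
  have hk0 : k ≠ 0 := by
    rintro rfl
    simp at hk
  rcases ne_or_eq (f.eval 0) 0 with h0 | h0
  · exact exists_dvd_pow_sub_X_of_eval_zero_ne_zero hk hf hroots h0
  obtain ⟨f', rfl⟩ : X ∣ f := X_dvd_iff.mpr (by rwa [coeff_zero_eq_eval_zero])
  rw [pow_two, mul_dvd_mul_iff_left X_ne_zero] at hf0
  have hf'0 : f'.eval 0 ≠ 0 := fun h => hf0 (X_dvd_iff.mpr (by rwa [coeff_zero_eq_eval_zero]))
  have hne : X * f' ≠ 0 := mul_ne_zero X_ne_zero fun h => hf0 (h ▸ dvd_zero X)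
  obtain ⟨g, hg⟩ := exists_dvd_pow_sub_X_of_eval_zero_ne_zero hk
    (hf.of_dvd hne (dvd_mul_left _ _))
    (fun a ha => hroots a (Multiset.mem_of_le (roots.le_of_dvd hne (dvd_mul_left _ _)) ha)) hf'0
  have hcop : IsCoprime X f' := (irreducible_X.coprime_iff_not_dvd).mpr hf0
  obtain ⟨u, v, huv⟩ := id hcop
  refine ⟨u * X * g, hcop.mul_dvd ?_ ?_⟩
  · exact dvd_sub (dvd_pow ((dvd_mul_left X u).mul_right g) hk0) dvd_rfl
  · have hsub : u * X * g - g = f' * -(v * g) := by linear_combination g * huv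
    have hpow : f' ∣ (u * X * g) ^ k - g ^ k :=
      (Dvd.intro _ hsub.symm).trans (sub_dvd_pow_sub_pow _ _ k)
    simpa using dvd_add hpow hg

variable {ι : Type*} [Fintype ι]

theorem exists_matrix_pow_eq_of_charpoly_splits [DecidableEq ι] {k : ℕ} (hk : (k : F) ≠ 0)
    {M : Matrix ι ι F} (hM : M.charpoly.Splits) (hroots : ∀ a ∈ M.charpoly.roots, ∃ b, b ^ k = a)
    (hzero : ¬ X ^ 2 ∣ M.charpoly) : ∃ A : Matrix ι ι F, A ^ k = M := by
  obtain ⟨g, f, hg⟩ := exists_dvd_pow_sub_X hk hM hroots hzero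
  refine ⟨aeval M g, ?_⟩
  simpa [sub_eq_zero, Matrix.aeval_self_charpoly] using congrArg (aeval M) hg

variable [LinearOrder ι]

theorem exists_matrix_pow_eq_of_isUpperTriangular {k : ℕ} (hk : (k : F) ≠ 0) {T : Matrix ι ι F}
    (hT : T.IsUpperTriangular) {a : ι → F} (hdiag : ∀ i, T i i = a i ^ k)
    (ha : {i | a i = 0}.Subsingleton) : ∃ A : Matrix ι ι F, A ^ k = T := by
  classical
  have hk0 : k ≠ 0 := by
    rintro rfl
    simp at hk
  have hchar : T.charpoly = ∏ i, (X - C (a i ^ k)) := by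
    simp_rw [Matrix.charpoly_of_isUpperTriangular T hT, hdiag]
  have hroots : T.charpoly.roots = univ.val.map fun i => a i ^ k := by
    rw [hchar]
    exact roots_multiset_prod_X_sub_C (univ.val.map fun i => a i ^ k) ▸ by simp
  refine exists_matrix_pow_eq_of_charpoly_splits hk ?_ ?_ ?_
  · rw [hchar]
    exact .prod fun i _ => .X_sub_C _
  · rw [hroots]
    simp
  · intro hdvd
    have hcount : 2 ≤ (univ.val.map fun i => a i ^ k).count 0 := by
      rw [← hroots, count_roots, le_rootMultiplicity_iff T.charpoly_monic.ne_zero, C_0, sub_zero]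
      exact hdvd
    rw [Multiset.count_map, ← filter_val, card_val] at hcount
    obtain ⟨i, hi, j, hj, hij⟩ := one_lt_card.mp hcount
    have hzero {i} (hi : i ∈ ({i | 0 = a i ^ k} : Finset ι)) : a i = 0 :=
      (pow_eq_zero_iff hk0).mp (mem_filter.mp hi).2.symm
    exact hij (ha (hzero hi) (hzero hj))

theorem exists_pow_add_pow_eq_of_diag {k : ℕ} (hk : (k : F) ≠ 0) (M : Matrix ι ι F) (a b : ι → F)
    (hM : ∀ i, M i i = a i ^ k + b i ^ k) (ha : {i | a i = 0}.Subsingleton)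
    (hb : {i | b i = 0}.Subsingleton) : ∃ A B : Matrix ι ι F, A ^ k + B ^ k = M := by
  let L : Matrix ι ι F := .of fun i j => if j < i then M i j else if i = j then a i ^ k else 0
  let U : Matrix ι ι F := .of fun i j => if i < j then M i j else if i = j then b i ^ k else 0
  have hL : L.transpose.IsUpperTriangular := fun i j (hij : j < i) => by
    simp [L, hij.not_gt, hij.ne]
  have hU : U.IsUpperTriangular := fun i j (hij : j < i) => by
    simp [U, hij.not_gt, hij.ne']
  obtain ⟨A, hA⟩ := exists_matrix_pow_eq_of_isUpperTriangular hk hL (by simp [L]) ha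
  obtain ⟨B, hB⟩ := exists_matrix_pow_eq_of_isUpperTriangular hk hU (by simp [U]) hb
  refine ⟨A.transpose, B, ?_⟩
  rw [← Matrix.transpose_pow, hA, hB, Matrix.transpose_transpose]
  ext i j
  rcases lt_trichotomy i j with h | rfl | h
  · simp [L, U, h, h.not_gt, h.ne]
  · simp [L, U, hM]
  · simp [L, U, h, h.not_gt, h.ne']

end RootsOfMatrices

section PrescribedDiagonal

theorem exists_linearEquiv_apply_eq_of_linearIndependent {K V κ : Type*} [Field K]
    [AddCommGroup V] [Module K V] [Finite κ] {u v : κ → V} (hu : LinearIndependent K u)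
    (hv : LinearIndependent K v) : ∃ g : V ≃ₗ[K] V, ∀ i, g (u i) = v i := by
  have : FiniteDimensional K (Submodule.span K (Set.range u)) :=
    .span_of_finite K (Set.finite_range u)
  let e := hu.linearCombinationEquiv.symm ≪≫ₗ hv.linearCombinationEquiv
  obtain ⟨g, hg⟩ := Submodule.exists_linearEquiv_restrict_eq e
  refine ⟨g, fun i => ?_⟩
  have he : e (hu.linearCombinationEquiv (Finsupp.single i 1)) =
      hv.linearCombinationEquiv (Finsupp.single i 1) := by simp [e]
  simpa using (hg (hu.linearCombinationEquiv (Finsupp.single i 1))).symm.trans (congrArg _ he)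

open scoped Matrix

variable {F ι : Type*} [Field F] [Fintype ι] [DecidableEq ι]

theorem exists_units_conj_apply_eq_one {M : Matrix ι ι F} (hM : M ∉ Set.range (Matrix.scalar ι)) :
    ∃ (P : (Matrix ι ι F)ˣ) (i₀ : ι), ∀ i ≠ i₀, (P⁻¹.val * M * P.val) i i₀ = 1 := by
  have hι : Nontrivial ι := by
    by_contra h
    rw [not_nontrivial_iff_subsingleton] at h
    refine hM ?_
    rcases isEmpty_or_nonempty ι with _ | ⟨⟨i⟩⟩
    · exact ⟨0, Subsingleton.elim _ _⟩
    · exact ⟨M i i, by ext j l; simp [Subsingleton.elim j i, Subsingleton.elim l i]⟩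
  obtain ⟨i₀, i₁, h01⟩ := exists_pair_ne ι
  obtain ⟨v, hv⟩ : ∃ v, LinearIndependent F ![v, M.toLin' v] := by
    by_contra! h
    obtain ⟨a, ha⟩ := LinearMap.exists_eq_smul_id_of_forall_notLinearIndependent h
    refine hM ⟨a, Matrix.toLin'.injective ?_⟩
    rw [ha]
    ext
    simp [Pi.single_apply]
  let w : ι → F := fun i => if i = i₀ then 0 else 1
  have hw : LinearIndependent F ![Pi.single i₀ 1, w] := by
    refine LinearIndependent.pair_iff.mpr fun s t hst => ?_
    have hs := congrFun hst i₀
    have ht := congrFun hst i₁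
    simp_all [w, h01.symm]
  obtain ⟨g, hg⟩ := exists_linearEquiv_apply_eq_of_linearIndependent hw hv
  let P := Units.map (LinearMap.toMatrixAlgEquiv' (R := F) (n := ι)).toMonoidHom
    (LinearMap.GeneralLinearGroup.ofLinearEquiv g)
  have hP (x : ι → F) : P.val *ᵥ x = g x := LinearMap.toMatrix'_mulVec g.toLinearMap x
  have hcol : (P⁻¹.val * M * P.val) *ᵥ Pi.single i₀ 1 = w := by
    have hg₀ : g (Pi.single i₀ 1) = v := hg 0
    have hg₁ : g w = M *ᵥ v := hg 1
    rw [← Matrix.mulVec_mulVec, ← Matrix.mulVec_mulVec, hP, hg₀, ← hg₁, ← hP,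
      Matrix.mulVec_mulVec, P.inv_mul, Matrix.one_mulVec]
  refine ⟨P, i₀, fun i hi => ?_⟩
  simpa [w, hi] using congrFun hcol i

theorem exists_units_conj_diag_eq {M : Matrix ι ι F} (hM : M ∉ Set.range (Matrix.scalar ι))
    {c : ι → F} (hc : ∑ i, c i = M.trace) :
    ∃ P : (Matrix ι ι F)ˣ, ∀ i, (P.val * M * P⁻¹.val) i i = c i := by
  obtain ⟨P, i₀, hP⟩ := exists_units_conj_apply_eq_one hM
  set Y := P⁻¹.val * M * P.val with hY
  let t : ι → F := fun i => if i = i₀ then 0 else c i - Y i i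
  let N : Matrix ι ι F := Matrix.vecMulVec (Pi.single i₀ 1) t
  have hN : N * N = 0 := by
    simp [N, t, Matrix.vecMulVec_mul_vecMulVec]
  let Q : (Matrix ι ι F)ˣ := ⟨1 - N, 1 + N, by noncomm_ring; simp [hN], by noncomm_ring; simp [hN]⟩
  have hoff (i : ι) (hi : i ≠ i₀) : ((1 - N) * (Y * (1 + N))) i i = c i := by
    simp [N, sub_mul, mul_add, Matrix.vecMulVec_mul, Matrix.mul_vecMulVec, Matrix.vecMulVec_apply,
      Matrix.vecMulVec_mulVec, hi, hP i hi, t]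
  have hconj : (Q * P⁻¹).val * M * (Q * P⁻¹)⁻¹.val = (1 - N) * (Y * (1 + N)) := by
    simp [Q, hY, mul_assoc]
  refine ⟨Q * P⁻¹, fun i => ?_⟩
  rcases ne_or_eq i i₀ with hi | rfl
  · rw [hconj, hoff i hi]
  have htrace := hc.trans (Matrix.trace_units_conj (Q * P⁻¹) M).symm
  rw [hconj] at htrace ⊢
  rw [Matrix.trace, ← add_sum_erase _ _ (mem_univ i), ← add_sum_erase _ _ (mem_univ i),
    sum_congr rfl fun j hj => (hoff j (ne_of_mem_erase hj)).symm] at htrace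
  exact (add_right_cancel htrace).symm

end PrescribedDiagonal

section SumsOfTwoPowersOfMatrices

theorem exists_matrix_pow_add_pow_eq_scalar {F R ι : Type*} [Field F] [Ring R] [Algebra F R]
    [Fintype ι] [DecidableEq ι] (b : Module.Basis ι F R) {k : ℕ} {t : F}
    (h : ∃ x y : R, x ^ k + y ^ k = algebraMap F R t) :
    ∃ A B : Matrix ι ι F, A ^ k + B ^ k = Matrix.scalar ι t := by
  obtain ⟨x, y, hxy⟩ := h
  let φ := Algebra.leftMulMatrix b
  refine ⟨φ x, φ y, ?_⟩
  rw [← map_pow, ← map_pow, ← map_add, hxy, AlgHom.commutes]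
  rfl

theorem subsingleton_setOf_cons_cons_one_eq_zero {R : Type*} [Zero R] [One R]
    [NeZero (1 : R)] {m : ℕ} {x y : R} (hx : x ≠ 0) :
    {i | (Fin.cons y (Fin.cons x fun _ => 1) : Fin (m + 2) → R) i = 0}.Subsingleton := by
  refine Set.subsingleton_of_subset_singleton (a := 0) fun i => ?_
  refine Fin.cases (fun _ => rfl) (fun i => Fin.cases ?_ (fun i => ?_) i) i <;> simp [hx]

variable {F : Type*} [Field F] [Fintype F]

theorem exists_extension_pow_add_pow_eq_algebraMap (p : ℕ) [Fact p.Prime] [CharP F p] {k m : ℕ}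
    [NeZero m] (hk : k ≠ 0)
    (hcard : (k.gcd (Fintype.card F ^ m - 1) - 1) ^ 4 < Fintype.card F ^ m) (t : F) :
    ∃ x y : FiniteField.Extension F p m, x ^ k + y ^ k = algebraMap F _ t := by
  have := Fintype.ofFinite (FiniteField.Extension F p m)
  have hcard' : Fintype.card (FiniteField.Extension F p m) = Fintype.card F ^ m := by
    rw [← Nat.card_eq_fintype_card, ← Nat.card_eq_fintype_card, FiniteField.natCard_extension]
  exact exists_pow_add_pow_eq hk (by rwa [hcard']) _

theorem exists_matrix_pow_add_pow_eq_scalar_of_card {n k : ℕ} (hn : 2 ≤ n) (hk : k ≠ 0)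
    (h₂ : (k.gcd (Fintype.card F ^ 2 - 1) - 1) ^ 4 < Fintype.card F ^ 2)
    (h₃ : (k.gcd (Fintype.card F ^ 3 - 1) - 1) ^ 4 < Fintype.card F ^ 3) (t : F) :
    ∃ A B : Matrix (Fin n) (Fin n) F, A ^ k + B ^ k = Matrix.scalar (Fin n) t := by
  obtain ⟨p, _⟩ := CharP.exists F
  have : Fact p.Prime := ⟨CharP.char_is_prime F p⟩
  obtain ⟨x₂, y₂, hxy₂⟩ := exists_extension_pow_add_pow_eq_algebraMap p hk h₂ t
  obtain ⟨x₃, y₃, hxy₃⟩ := exists_extension_pow_add_pow_eq_algebraMap p hk h₃ t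
  obtain ⟨a, b, hab⟩ : ∃ a b : ℕ, 2 * a + 3 * b = n := by
    rcases Nat.even_or_odd' n with ⟨m, h | h⟩
    · exact ⟨m, 0, by omega⟩
    · exact ⟨m - 1, 1, by omega⟩
  let R := (Fin a → FiniteField.Extension F p 2) × (Fin b → FiniteField.Extension F p 3)
  have hR : Module.finrank F R = n := by
    simp [R, Module.finrank_prod, Module.finrank_pi_fintype, FiniteField.finrank_extension,
      ← hab, mul_comm]
  exact exists_matrix_pow_add_pow_eq_scalar (Module.finBasisOfFinrankEq F R hR)
    ⟨(fun _ => x₂, fun _ => x₃), (fun _ => y₂, fun _ => y₃),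
      Prod.ext (funext fun _ => hxy₂) (funext fun _ => hxy₃)⟩

theorem exists_diag_pow_add_pow_sum_eq {n k : ℕ} (hn : 2 ≤ n) (hk : k ≠ 0)
    (hcard : (k.gcd (Fintype.card F - 1) - 1) ^ 3 + 1 < Fintype.card F) (t : F) :
    ∃ a b : Fin n → F, {i | a i = 0}.Subsingleton ∧ {i | b i = 0}.Subsingleton ∧
      ∑ i, (a i ^ k + b i ^ k) = t := by
  obtain ⟨m, rfl⟩ := Nat.exists_eq_add_of_le' hn
  obtain ⟨x₁, y₁, x₂, y₂, hx₁, hx₂, hsum⟩ :=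
    exists_pow_add_pow_add_pow_add_pow_eq hk hcard (t - 2 * m)
  refine ⟨_, _, subsingleton_setOf_cons_cons_one_eq_zero (y := y₁) hx₁,
    subsingleton_setOf_cons_cons_one_eq_zero (y := y₂) hx₂, ?_⟩
  simp only [Fin.sum_univ_succ, Fin.cons_zero, Fin.cons_succ, one_pow, sum_const, card_univ,
    Fintype.card_fin, nsmul_eq_mul]
  linear_combination hsum

theorem exists_matrix_pow_add_pow_eq_of_notMem_range_scalar {n k : ℕ} (hn : 2 ≤ n)
    (hk : (k : F) ≠ 0) (hcard : (k.gcd (Fintype.card F - 1) - 1) ^ 3 + 1 < Fintype.card F)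
    {M : Matrix (Fin n) (Fin n) F} (hM : M ∉ Set.range (Matrix.scalar (Fin n))) :
    ∃ A B : Matrix (Fin n) (Fin n) F, A ^ k + B ^ k = M := by
  have hk₀ : k ≠ 0 := fun h => hk (by simp [h])
  obtain ⟨a, b, ha, hb, htrace⟩ := exists_diag_pow_add_pow_sum_eq hn hk₀ hcard M.trace
  obtain ⟨P, hP⟩ := exists_units_conj_diag_eq hM htrace
  obtain ⟨A, B, hAB⟩ := exists_pow_add_pow_eq_of_diag hk _ a b hP ha hb
  refine ⟨P⁻¹.val * A * P.val, P⁻¹.val * B * P.val, ?_⟩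
  rw [Units.conj_pow', Units.conj_pow', ← add_mul, ← mul_add, hAB]
  simp [mul_assoc]

theorem exists_matrix_pow_add_pow_eq {n k : ℕ} (hn : 2 ≤ n) (hk : (k : F) ≠ 0)
    (h₁ : (k.gcd (Fintype.card F - 1) - 1) ^ 3 + 1 < Fintype.card F)
    (h₂ : (k.gcd (Fintype.card F ^ 2 - 1) - 1) ^ 4 < Fintype.card F ^ 2)
    (h₃ : (k.gcd (Fintype.card F ^ 3 - 1) - 1) ^ 4 < Fintype.card F ^ 3)
    (M : Matrix (Fin n) (Fin n) F) : ∃ A B : Matrix (Fin n) (Fin n) F, A ^ k + B ^ k = M := by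
  by_cases hM : M ∈ Set.range (Matrix.scalar (Fin n))
  · obtain ⟨t, rfl⟩ := hM
    exact exists_matrix_pow_add_pow_eq_scalar_of_card hn (fun h => hk (by simp [h])) h₂ h₃ t
  · exact exists_matrix_pow_add_pow_eq_of_notMem_range_scalar hn hk h₁ hM

end SumsOfTwoPowersOfMatrices

section NumericalBounds

theorem pow_three_add_one_lt_of_sqrt_le {d q : ℕ} (hdq : d ∣ q - 1) (hq : 2 ≤ q)
    (h : √(((d : ℝ) - 1) ^ 6 + 6 * (d : ℝ)) ≤ q) : (d - 1) ^ 3 + 1 < q := by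
  have hd : d ≠ 0 := by
    rintro rfl
    omega
  obtain ⟨e, rfl⟩ := Nat.exists_eq_succ_of_ne_zero hd
  rw [Real.sqrt_le_left (by positivity), Nat.cast_succ, add_sub_cancel_right] at h
  have hsq : e ^ 6 + 6 * (e + 1) ≤ q ^ 2 := by exact_mod_cast h
  rw [Nat.succ_sub_one]
  have hlt : e ^ 3 < q := lt_of_pow_lt_pow_left₀ 2 q.zero_le (by rw [← pow_mul]; lia)
  refine lt_of_le_of_ne hlt fun heq => ?_
  have hdvd : e + 1 ∣ e ^ 3 := by simpa [← heq] using hdq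
  have hone : e + 1 = 1 := Nat.Coprime.eq_one_of_dvd (by simp) hdvd
  obtain rfl : e = 0 := by omega
  omega

theorem pow_four_lt_sq_of_sq_add_one_le {d q : ℕ} (hd : d ≠ 0) (h : ((d : ℝ) - 1) ^ 2 + 1 ≤ q) :
    (d - 1) ^ 4 < q ^ 2 := by
  obtain ⟨e, rfl⟩ := Nat.exists_eq_succ_of_ne_zero hd
  rw [Nat.cast_succ, add_sub_cancel_right] at h
  have hlt : e ^ 2 < q := by exact_mod_cast h
  calc e ^ 4 = (e ^ 2) ^ 2 := by ring
    _ < q ^ 2 := Nat.pow_lt_pow_left hlt two_ne_zero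

theorem pow_four_lt_pow_three_of_floor_rpow_add_one_le {d q : ℕ} (hd : d ≠ 0)
    (h : (⌊((d : ℝ) - 1) ^ ((4 : ℝ) / 3)⌋ : ℝ) + 1 ≤ q) : (d - 1) ^ 4 < q ^ 3 := by
  obtain ⟨e, rfl⟩ := Nat.exists_eq_succ_of_ne_zero hd
  rw [Nat.cast_succ, add_sub_cancel_right] at h
  have hlt : (e : ℝ) ^ ((4 : ℝ) / 3) < q := (Int.lt_floor_add_one _).trans_le h
  have hpow : (e : ℝ) ^ 4 < (q : ℝ) ^ 3 := by
    calc (e : ℝ) ^ 4 = ((e : ℝ) ^ ((4 : ℝ) / 3)) ^ 3 := by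
          rw [← Real.rpow_natCast, ← Real.rpow_natCast, ← Real.rpow_mul (by positivity)]
          norm_num
      _ < (q : ℝ) ^ 3 := pow_lt_pow_left₀ hlt (by positivity) three_ne_zero
  exact_mod_cast hpow

end NumericalBounds

theorem theorem1p8 {F : Type*} [Field F] [Fintype F] (p l q k n : ℕ)
    (hp : p.Prime) (hq : q = p ^ l) (hF : Fintype.card F = q)
    (hn : 2 ≤ n) (hpk : ¬ p ∣ k)
    (hbound :
      max (Real.sqrt (((dGcd k q 1 : ℝ) - 1) ^ 6 + 6 * (dGcd k q 1 : ℝ)))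
        (max (((dGcd k q 2 : ℝ) - 1) ^ 2 + 1)
          ((⌊((dGcd k q 3 : ℝ) - 1) ^ ((4 : ℝ) / 3)⌋ : ℝ) + 1)) ≤ (q : ℝ)) :
    sumTwoPowers k n F = Set.univ := by
  have : Fact p.Prime := ⟨hp⟩
  have : CharP F p := charP_of_card_eq_prime_pow (hF.trans hq)
  have hk : (k : F) ≠ 0 := by rwa [Ne, CharP.cast_eq_zero_iff F p]
  have hd (m : ℕ) : dGcd k q m ≠ 0 := Nat.gcd_ne_zero_left fun h => hk (by simp [h])
  obtain ⟨hb₁, hb₂, hb₃⟩ := by simpa only [max_le_iff] using hbound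
  have hd₁ : dGcd k q 1 ∣ q - 1 := by simpa only [dGcd, pow_one] using Nat.gcd_dvd_right k (q - 1)
  have h₁ := pow_three_add_one_lt_of_sqrt_le hd₁ (hF ▸ Fintype.one_lt_card) hb₁
  have h₂ := pow_four_lt_sq_of_sq_add_one_le (hd 2) hb₂
  have h₃ := pow_four_lt_pow_three_of_floor_rpow_add_one_le (hd 3) hb₃
  simp only [dGcd, pow_one, ← hF] at h₁ h₂ h₃
  refine Set.eq_univ_of_forall fun M => ?_
  obtain ⟨A, B, hAB⟩ := exists_matrix_pow_add_pow_eq hn hk h₁ h₂ h₃ M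
  exact ⟨A, B, hAB.symm⟩
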